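/- Let $d_A,d_B$ be natural numbers and let $U$ be a bipartite permutation unitary on $\mathbb{C}^{d_A}\otimes\mathbb{C}^{d_B}$, i.e. a unitary matrix in the computational product basis all of whose entries are $0$ or $1$. Suppose that $U$ has Schmidt rank $r>2$, i.e. $U=\sum_{j=1}^{r}A_j\otimes B_j$ with $A_1,\dots,A_r$ linearly independent $d_A\times d_A$ complex matrices and $B_1,\dots,B_r$ linearly independent $d_B\times d_B$ complex matrices. Then the entangling power of $U$ is greater than $1.223$ ebits: $$K_E(U):=\sup_{|\alpha\rangle,|\beta\rangle}E\bigl((U_{AB}\otimes I_{R_AR_B})(|\alpha\rangle_{AR_A}\otimes|\beta\rangle_{BR_B})\bigr)>1.223 .$$ Here the supremum is over all finite-dimensional ancillary systems $R_A,R_B$ and all unit vectors $|\alpha\rangle$ of $AR_A$ and $|\beta\rangle$ of $BR_B$, and $E(|\psi\rangle)=-\mathrm{Tr}(\rho\log_2\rho)$ is the von Neumann entropy, in bits, of the reduced density matrix $\rho$ of $|\psi\rangle$ on $AR_A$. -/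

import Mathlib

open scoped Kronecker

namespace EntanglingPower

/-- A permutation unitary: a unitary matrix all of whose entries are `0` or `1`. -/
def IsPermutationUnitary {X : Type*} [Fintype X] [DecidableEq X] (U : Matrix X X ℂ) : Prop :=
  U ∈ Matrix.unitaryGroup X ℂ ∧ ∀ i j, U i j = 0 ∨ U i j = 1

/-- The operator `U` on `ℂ^A ⊗ ℂ^B` has (operator-)Schmidt rank `r`: it is a sum of `r` tensor
products `P j ⊗ Q j` with the `P j` linearly independent and the `Q j` linearly independent. -/
def HasSchmidtRank {A B : Type*} (U : Matrix (A × B) (A × B) ℂ) (r : ℕ) : Prop :=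
  ∃ (P : Fin r → Matrix A A ℂ) (Q : Fin r → Matrix B B ℂ),
    LinearIndependent ℂ P ∧ LinearIndependent ℂ Q ∧ U = ∑ j, P j ⊗ₖ Q j

/-- The amplitudes of the tensor product of two states. -/
def productState {X Y : Type*} (α : EuclideanSpace ℂ X) (β : EuclideanSpace ℂ Y) :
    EuclideanSpace ℂ (X × Y) :=
  WithLp.toLp 2 fun p => α p.1 * β p.2

/-- The action of `U`, an operator on the systems `A` and `B`, on a state of the four systems
`A`, `R`, `B`, `S`; the identity acts on the ancillae `R` and `S`. -/
def applyGate {A B R S : Type*} [Fintype A] [Fintype B] (U : Matrix (A × B) (A × B) ℂ)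
    (ψ : EuclideanSpace ℂ ((A × R) × (B × S))) : EuclideanSpace ℂ ((A × R) × (B × S)) :=
  WithLp.toLp 2 fun p =>
    ∑ a, ∑ b, U (p.1.1, p.2.1) (a, b) * ψ ((a, p.1.2), (b, p.2.2))

/-- The reduced density matrix `Tr_Y |ψ⟩⟨ψ|` on the system `X` of a vector `ψ ∈ ℂ^X ⊗ ℂ^Y`. -/
def reducedDensity {X Y : Type*} [Fintype Y] (ψ : EuclideanSpace ℂ (X × Y)) : Matrix X X ℂ :=
  Matrix.of fun x x' => ∑ y, ψ (x, y) * star (ψ (x', y))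

theorem reducedDensity_isHermitian {X Y : Type*} [Fintype Y] (ψ : EuclideanSpace ℂ (X × Y)) :
    (reducedDensity ψ).IsHermitian := by
  ext x x'
  simp [reducedDensity, mul_comm]

/-- The von Neumann entropy `-Tr (ρ log₂ ρ)` of a Hermitian matrix, in bits
(with `0 log₂ 0 = 0`). -/
noncomputable def vonNeumannEntropy {X : Type*} [Fintype X] [DecidableEq X]
    {ρ : Matrix X X ℂ} (hρ : ρ.IsHermitian) : ℝ :=
  -∑ i, hρ.eigenvalues i * Real.logb 2 (hρ.eigenvalues i)

/-- The entanglement (in ebits) of a bipartite pure state: the von Neumann entropy of its reduced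
density matrix. -/
noncomputable def entanglement {X Y : Type*} [Fintype X] [DecidableEq X] [Fintype Y]
    (ψ : EuclideanSpace ℂ (X × Y)) : ℝ :=
  vonNeumannEntropy (reducedDensity_isHermitian ψ)

/-- The entangling power (in ebits) of `U`: the supremum, over all finite ancilla dimensions
`m`, `n` and all pure states `α` of `A R_A` and `β` of `B R_B`, of the entanglement of
`U (α ⊗ β)` between `A R_A` and `B R_B`. The supremum is taken in the extended reals, where it
always exists. -/
noncomputable def entanglingPower {A B : Type*} [Fintype A] [DecidableEq A] [Fintype B]
    (U : Matrix (A × B) (A × B) ℂ) : EReal :=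
  ⨆ (m : ℕ) (n : ℕ)
    (α : {α : EuclideanSpace ℂ (A × Fin m) // ‖α‖ = 1})
    (β : {β : EuclideanSpace ℂ (B × Fin n) // ‖β‖ = 1}),
      ((entanglement (applyGate U (productState α.1 β.1)) : ℝ) : EReal)

end EntanglingPower

namespace EntanglingPower

open scoped ComplexOrder

/-! The entropy of a state is at least minus the base-2 logarithm of its purity `Tr ρ²`, and `log₂
(12/5) > 5/4`, so it suffices to find one product input whose output has purity at most `5/12`.

`U` permutes the basis vectors by a bijection `e`. If at some `(a, b)` the first output component
varies with `b` and the second varies with `a`, a weighted two-by-two input works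
(`hasLowPurityOutput_of_corner`). Otherwise, up to exchanging the systems, `U` is controlled: it
applies a permutation `π a` of `B`, and Schmidt rank above 2 forces three distinct `π a`.

If the three take three different values at some `b`, fix that `b`
(`hasLowPurityOutput_of_three_values`). If not, wherever they do not all agree exactly one is the
odd one out. Either each is odd somewhere, and a uniform three-by-three input works
(`hasLowPurityOutput_of_all_odd`), or one never is; relative to it the other two are disjoint
permutations, and a signed vector on `B` works (`hasLowPurityOutput_of_two_odd`). -/

/-! ### Entropy and purity -/

theorem sum_sq_eigenvalues {X : Type*} [Fintype X] [DecidableEq X] {ρ : Matrix X X ℂ}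
    (hρ : ρ.IsHermitian) : ∑ i, hρ.eigenvalues i ^ 2 = ∑ x, ∑ x', ‖ρ x x'‖ ^ 2 := by
  have h1 : (ρ * ρ).trace = ∑ i, ((hρ.eigenvalues i : ℂ)) ^ 2 := by
    have h := hρ.spectral_theorem
    rw [Unitary.conjStarAlgAut_apply] at h
    set V := (hρ.eigenvectorUnitary : Matrix X X ℂ)
    have hV : star V * V = 1 := Unitary.coe_star_mul_self _
    set D : Matrix X X ℂ := Matrix.diagonal (RCLike.ofReal ∘ hρ.eigenvalues)
    calc (ρ * ρ).trace = (V * D * star V * (V * D * star V)).trace := by rw [← h]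
      _ = (V * (D * (star V * V) * D) * star V).trace := by simp only [mul_assoc]
      _ = (D * D).trace := by
        rw [hV, mul_one, Matrix.trace_mul_comm, ← mul_assoc, hV, one_mul]
      _ = _ := by simp [D, Matrix.trace, pow_two]
  have h2 : (ρ * ρ).trace = ∑ x, ∑ x', ((‖ρ x x'‖ : ℂ)) ^ 2 := by
    simp only [Matrix.trace, Matrix.diag, Matrix.mul_apply]
    refine Finset.sum_congr rfl fun x _ => Finset.sum_congr rfl fun x' _ => ?_
    rw [← hρ.apply x' x, ← Complex.conj_mul']
    simp [mul_comm]
  have := h1.symm.trans h2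
  exact_mod_cast this

/-- Lower bound on the entropy by the collision entropy. -/
theorem neg_logb_le_vonNeumannEntropy {X : Type*} [Fintype X] [DecidableEq X]
    {ρ : Matrix X X ℂ} (hρ : ρ.PosSemidef) (htr : ρ.trace = 1) {P : ℝ} (hP : 0 < P)
    (h : ∑ x, ∑ x', ‖ρ x x'‖ ^ 2 ≤ P) :
    -Real.logb 2 P ≤ vonNeumannEntropy hρ.isHermitian := by
  set l := hρ.isHermitian.eigenvalues with hl
  have hsq : ∑ i, l i ^ 2 ≤ P := by rw [hl, sum_sq_eigenvalues]; exact h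
  have hsum : ∑ i, l i = 1 := by
    have := hρ.isHermitian.trace_eq_sum_eigenvalues
    rw [htr] at this
    have h' : ((∑ i, l i : ℝ) : ℂ) = 1 := by rw [this]; simp [hl]
    exact_mod_cast h'
  have hnn : ∀ i, 0 ≤ l i := fun i => hρ.eigenvalues_nonneg i
  -- This is `log t ≤ t - 1` at `t = l i / P`, multiplied by `l i`.
  have key : ∀ i, l i * Real.log (l i) ≤ l i * Real.log P + l i ^ 2 / P - l i := by
    intro i
    rcases (hnn i).eq_or_lt with h0 | h0
    · simp [← h0]
    · have := Real.log_le_sub_one_of_pos (div_pos h0 hP)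
      rw [Real.log_div h0.ne' hP.ne'] at this
      have := mul_le_mul_of_nonneg_left this h0.le
      have e : l i * (l i / P - 1) = l i ^ 2 / P - l i := by ring
      rw [e] at this
      linarith
  have hs : ∑ i, l i * Real.log (l i) ≤ Real.log P := by
    calc _ ≤ ∑ i, (l i * Real.log P + l i ^ 2 / P - l i) := Finset.sum_le_sum fun i _ => key i
      _ = Real.log P + (∑ i, l i ^ 2) / P - 1 := by
        rw [Finset.sum_sub_distrib, Finset.sum_add_distrib, ← Finset.sum_mul, hsum,
          ← Finset.sum_div, one_mul]
      _ ≤ Real.log P := by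
        have : (∑ i, l i ^ 2) / P ≤ 1 := (div_le_one hP).2 hsq
        linarith
  have h2 : 0 < Real.log 2 := Real.log_pos (by norm_num)
  unfold vonNeumannEntropy
  rw [neg_le_neg_iff]
  simp only [Real.logb, ← mul_div_assoc, ← Finset.sum_div]
  exact div_le_div_of_nonneg_right hs h2.le

theorem reducedDensity_posSemidef {X Y : Type*} [Fintype X] [Fintype Y]
    (ψ : EuclideanSpace ℂ (X × Y)) : (reducedDensity ψ).PosSemidef := by
  have : reducedDensity ψ = (Matrix.of fun x y => ψ (x, y)) *
      (Matrix.of fun x y => ψ (x, y)).conjTranspose := by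
    ext x x'
    simp [reducedDensity, Matrix.mul_apply]
  rw [this]
  exact Matrix.posSemidef_self_mul_conjTranspose _

/-- The purity `Tr (M Mᵀ)²` of the reduced state of the vector with real amplitudes `M`. -/
def purity {X Y : Type*} [Fintype X] [Fintype Y] (M : X → Y → ℝ) : ℝ :=
  ∑ x, ∑ x', (∑ y, M x y * M x' y) ^ 2

theorem purity_eq_sum {X Y : Type*} [Fintype X] [Fintype Y] (M : X → Y → ℝ) :
    purity M = ∑ p : X × X, ∑ q : Y × Y, M p.1 q.1 * M p.2 q.1 * (M p.1 q.2 * M p.2 q.2) := by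
  simp only [purity, Fintype.sum_prod_type, pow_two, Finset.sum_mul_sum]

/-- `M Mᵀ` and `Mᵀ M` have squares of equal trace; this makes the two systems interchangeable. -/
theorem purity_swap {X Y : Type*} [Fintype X] [Fintype Y] (M : X → Y → ℝ) :
    purity (fun y x => M x y) = purity M := by
  rw [purity_eq_sum, purity_eq_sum, Finset.sum_comm]
  refine Finset.sum_congr rfl fun p _ => Finset.sum_congr rfl fun q _ => ?_
  ring

theorem lt_entanglement {X Y : Type*} [Fintype X] [DecidableEq X] [Fintype Y]
    (ψ : EuclideanSpace ℂ (X × Y)) (M : X → Y → ℝ) (hψ : ∀ x y, ψ (x, y) = (M x y : ℂ))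
    (h1 : ∑ x, ∑ y, M x y ^ 2 = 1) (h : purity M ≤ 5 / 12) : 1.223 < entanglement ψ := by
  have hent : ∀ x x', reducedDensity ψ x x' = ((∑ y, M x y * M x' y : ℝ) : ℂ) := by
    intro x x'
    simp [reducedDensity, hψ]
  have htr : (reducedDensity ψ).trace = 1 := by
    have : ((∑ x, ∑ y, M x y ^ 2 : ℝ) : ℂ) = 1 := by rw [h1]; simp
    rw [← this]
    simp only [Matrix.trace, Matrix.diag, hent]
    push_cast
    simp only [pow_two]
  have hb := neg_logb_le_vonNeumannEntropy (reducedDensity_posSemidef ψ) htr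
    (P := 5 / 12) (by norm_num) (by
      refine le_trans (le_of_eq ?_) h
      simp only [hent, purity, Complex.norm_real, Real.norm_eq_abs, sq_abs])
  refine lt_of_lt_of_le ?_ hb
  -- `(12/5)⁴ > 33 > 2⁵`, so the bound reached is in fact `5/4`.
  have h4 : (5 : ℝ) < 4 * Real.logb 2 (12 / 5) := by
    have : (4 : ℝ) * Real.logb 2 (12 / 5) = Real.logb 2 ((12 / 5) ^ 4) := by
      rw [Real.logb_pow]; norm_num
    rw [this, Real.lt_logb_iff_rpow_lt (by norm_num) (by norm_num)]
    norm_num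
  rw [← Real.logb_inv, show ((5 : ℝ) / 12)⁻¹ = 12 / 5 by norm_num]
  linarith

/-! ### Product inputs sent through a basis permutation -/

/-- The amplitudes of the image of `α ⊗ β` under the permutation `e` of basis vectors. -/
def amplitude {A B : Type*} (e : A × B ≃ A × B) {R S : Type*} (α : A → R → ℝ) (β : B → S → ℝ)
    (x : A × R) (y : B × S) : ℝ :=
  α (e.symm (x.1, y.1)).1 x.2 * β (e.symm (x.1, y.1)).2 y.2

/-- Some product input with real amplitudes is mapped by `e` to a state of purity at most
`5 / 12`. -/
def HasLowPurityOutput {A B : Type*} [Fintype A] [Fintype B] (e : A × B ≃ A × B) : Prop :=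
  ∃ (m n : ℕ) (α : A → Fin m → ℝ) (β : B → Fin n → ℝ),
    ∑ a, ∑ i, α a i ^ 2 = 1 ∧ ∑ b, ∑ j, β b j ^ 2 = 1 ∧ purity (amplitude e α β) ≤ 5 / 12

/-- The same permutation with the two systems exchanged. -/
def exchange {A B : Type*} (e : A × B ≃ A × B) : B × A ≃ B × A :=
  ((Equiv.prodComm B A).trans e).trans (Equiv.prodComm A B)

theorem hasLowPurityOutput_of_exchange {A B : Type*} [Fintype A] [Fintype B]
    {e : A × B ≃ A × B} (h : HasLowPurityOutput (exchange e)) : HasLowPurityOutput e := by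
  obtain ⟨m, n, α, β, hα, hβ, h⟩ := h
  refine ⟨n, m, β, α, hβ, hα, ?_⟩
  rw [← purity_swap]
  refine le_trans (le_of_eq ?_) h
  congr 1
  funext x y
  simp [amplitude, exchange, mul_comm]

theorem sum_sq_amplitude {A B : Type*} [Fintype A] [Fintype B] (e : A × B ≃ A × B) {R S : Type*}
    [Fintype R] [Fintype S] (α : A → R → ℝ) (β : B → S → ℝ) :
    ∑ x, ∑ y, amplitude e α β x y ^ 2 = (∑ a, ∑ i, α a i ^ 2) * ∑ b, ∑ j, β b j ^ 2 := by
  have h : ∀ F : A → R → B → S → ℝ, ∑ x : A × R, ∑ y : B × S, F x.1 x.2 y.1 y.2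
      = ∑ p : A × B, ∑ i, ∑ j, F p.1 i p.2 j := by
    intro F
    simp only [Fintype.sum_prod_type]
    refine Finset.sum_congr rfl fun a _ => ?_
    rw [Finset.sum_comm]
  have h' := h fun a i b j => (α (e.symm (a, b)).1 i * β (e.symm (a, b)).2 j) ^ 2
  simp only [amplitude]
  rw [h', Equiv.sum_comp e.symm fun p => ∑ i, ∑ j, (α p.1 i * β p.2 j) ^ 2,
    Fintype.sum_prod_type, Finset.sum_mul_sum]
  refine Finset.sum_congr rfl fun a _ => Finset.sum_congr rfl fun b _ => ?_
  rw [Finset.sum_mul_sum]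
  simp only [mul_pow]

theorem norm_toLp_ofReal_eq_one {X R : Type*} [Fintype X] [Fintype R] {γ : X → R → ℝ}
    (hγ : ∑ a, ∑ i, γ a i ^ 2 = 1) :
    ‖(WithLp.toLp 2 fun p : X × R => ((γ p.1 p.2 : ℝ) : ℂ) : EuclideanSpace ℂ (X × R))‖ = 1 := by
  rw [EuclideanSpace.norm_eq, Real.sqrt_eq_one, ← hγ, Fintype.sum_prod_type]
  simp

theorem lt_entanglingPower {A B : Type*} [Fintype A] [DecidableEq A] [Fintype B] [DecidableEq B]
    {U : Matrix (A × B) (A × B) ℂ} {e : A × B ≃ A × B}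
    (hU : ∀ x y, U x y = if e y = x then 1 else 0) (h : HasLowPurityOutput e) :
    ((1.223 : ℝ) : EReal) < entanglingPower U := by
  obtain ⟨m, n, α, β, hα, hβ, h⟩ := h
  refine lt_of_lt_of_le ?_ (le_iSup_of_le m <| le_iSup_of_le n <|
    le_iSup_of_le ⟨_, norm_toLp_ofReal_eq_one hα⟩ <|
    le_iSup_of_le ⟨_, norm_toLp_ofReal_eq_one hβ⟩ le_rfl)
  rw [EReal.coe_lt_coe_iff]
  refine lt_entanglement _ (amplitude e α β) ?_ ?_ h
  · rintro ⟨a, i⟩ ⟨b, j⟩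
    simp only [applyGate, productState, hU, amplitude]
    rw [← Fintype.sum_prod_type'
      (f := fun a' b' => (if e (a', b') = (a, b) then (1 : ℂ) else 0) * (α a' i * β b' j))]
    simp only [← Equiv.eq_symm_apply, ite_mul, one_mul, zero_mul, Prod.mk.eta]
    simp
  · rw [sum_sq_amplitude, hα, hβ, one_mul]

/-! ### Permutation unitaries and Schmidt rank -/

theorem IsPermutationUnitary.exists_equiv {X : Type*} [Fintype X] [DecidableEq X]
    {U : Matrix X X ℂ} (hU : IsPermutationUnitary U) :
    ∃ e : X ≃ X, ∀ x y, U x y = if e y = x then 1 else 0 := by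
  obtain ⟨hu, h01⟩ := hU
  have aux : ∀ v : X → ℂ, (∀ x, v x = 0 ∨ v x = 1) → ∑ x, v x * star (v x) = 1 →
      ∃! x, v x = 1 := by
    intro v hv hs
    have : ∑ x, v x * star (v x) = ((Finset.univ.filter fun x => v x = 1).card : ℂ) := by
      rw [Finset.card_filter, Nat.cast_sum]
      refine Finset.sum_congr rfl fun x _ => ?_
      rcases hv x with h | h <;> simp [h]
    rw [this] at hs
    have hc : (Finset.univ.filter fun x => v x = 1).card = 1 := by exact_mod_cast hs
    obtain ⟨a, ha⟩ := Finset.card_eq_one.1 hc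
    refine ⟨a, ?_, fun y hy => ?_⟩
    · have : a ∈ Finset.univ.filter fun x => v x = 1 := by simp [ha]
      simpa using this
    · have : y ∈ Finset.univ.filter fun x => v x = 1 := by simpa using hy
      simpa [ha] using this
  have hcol : ∀ y, ∃! x, U x y = 1 := fun y => aux _ (fun x => h01 x y) (by
    have := congrFun (congrFun (Matrix.mem_unitaryGroup_iff'.1 hu) y) y
    rw [Matrix.star_eq_conjTranspose, Matrix.mul_apply] at this
    simpa [mul_comm] using this)
  have hrow : ∀ x, ∃! y, U x y = 1 := fun x => aux _ (fun y => h01 x y) (by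
    have := congrFun (congrFun (Matrix.mem_unitaryGroup_iff.1 hu) x) x
    rw [Matrix.star_eq_conjTranspose, Matrix.mul_apply] at this
    simpa using this)
  choose f hf hf' using hcol
  have hinj : Function.Injective f := fun y y' h =>
    (hrow (f y)).unique (hf y) (by rw [h]; exact hf y')
  refine ⟨Equiv.ofBijective f (Finite.injective_iff_bijective.1 hinj), fun x y => ?_⟩
  simp only [Equiv.ofBijective_apply]
  split_ifs with h
  · rw [← h]; exact hf y
  · exact (h01 x y).resolve_right fun h' => h (hf' y x h').symm

/-- The matrix `⟨a'| U |a⟩` on the second system. -/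
def block {A B : Type*} (U : Matrix (A × B) (A × B) ℂ) (a' a : A) : Matrix B B ℂ :=
  Matrix.of fun b' b => U (a', b') (a, b)

/-- A functional `φ` vanishing on all blocks gives `∑ φ (Q j) • P j = 0`, so it kills every `Q j`.
Hence the `Q j` lie in the span of `W`. -/
theorem HasSchmidtRank.le_card {A B : Type*}
    {U : Matrix (A × B) (A × B) ℂ} {r : ℕ} (h : HasSchmidtRank U r)
    (W : Finset (Matrix B B ℂ))
    (hW : ∀ a' a, block U a' a ∈ Submodule.span ℂ (W : Set (Matrix B B ℂ))) : r ≤ W.card := by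
  obtain ⟨P, Q, hP, hQ, hU⟩ := h
  have hb : ∀ a' a, block U a' a = ∑ j, P j a' a • Q j := by
    intro a' a
    ext b' b
    simp [block, hU, Matrix.sum_apply]
  have hmem : Set.range Q ≤ Submodule.span ℂ (W : Set (Matrix B B ℂ)) := by
    rintro _ ⟨j, rfl⟩
    by_contra hj
    obtain ⟨φ, hφ, hφW⟩ := Submodule.exists_le_ker_of_notMem hj
    refine hφ (Fintype.linearIndependent_iff.1 hP (fun j => φ (Q j)) ?_ j)
    ext a' a
    have := LinearMap.mem_ker.1 (hφW (hW a' a))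
    rw [hb] at this
    simpa [Matrix.sum_apply, mul_comm] using this
  simpa using linearIndependent_le_span_aux' Q hQ (W : Set (Matrix B B ℂ)) hmem

theorem HasSchmidtRank.exchange {A B : Type*} {U : Matrix (A × B) (A × B) ℂ} {r : ℕ}
    (h : HasSchmidtRank U r) : HasSchmidtRank (U.submatrix Prod.swap Prod.swap) r := by
  obtain ⟨P, Q, hP, hQ, rfl⟩ := h
  refine ⟨Q, P, hQ, hP, ?_⟩
  ext ⟨a, b⟩ ⟨a', b'⟩
  simp [Matrix.sum_apply, mul_comm]

/-- The only nonzero blocks are those from `a` to `f a`, and each is determined by `g a`; so the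
rank is at most the number of distinct `g a`. -/
theorem exists_three_controlled {A B : Type*} [Fintype A] [DecidableEq A] [DecidableEq B]
    {U : Matrix (A × B) (A × B) ℂ} {e : A × B ≃ A × B}
    (hU : ∀ x y, U x y = if e y = x then 1 else 0) {f : A → A} {g : A → B → B}
    (he : ∀ a b, e (a, b) = (f a, g a b)) {r : ℕ} (h : HasSchmidtRank U r) (hr : 2 < r) :
    ∃ a₁ a₂ a₃, g a₁ ≠ g a₂ ∧ g a₁ ≠ g a₃ ∧ g a₂ ≠ g a₃ := by
  classical
  have hc := h.le_card (Finset.univ.image fun a => block U (f a) a) (by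
    intro a' a
    by_cases ha : f a = a'
    · subst ha
      exact Submodule.subset_span (by simp)
    · have : block U a' a = 0 := by
        ext b' b
        simp [block, hU, he, ha]
      rw [this]
      exact Submodule.zero_mem _)
  obtain ⟨x, hx, y, hy, z, hz, hxy, hxz, hyz⟩ := Finset.two_lt_card.1 (hr.trans_le hc)
  have aux : ∀ a a', block U (f a) a ≠ block U (f a') a' → g a ≠ g a' := by
    intro a a' hne hg
    refine hne ?_
    ext b' b
    simp [block, hU, he, hg]
  simp only [Finset.mem_image, Finset.mem_univ, true_and] at hx hy hz
  obtain ⟨a₁, rfl⟩ := hx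
  obtain ⟨a₂, rfl⟩ := hy
  obtain ⟨a₃, rfl⟩ := hz
  exact ⟨a₁, a₂, a₃, aux _ _ hxy, aux _ _ hxz, aux _ _ hyz⟩

/-! ### Inputs whose ancillae record the basis label -/

theorem sum_sq_diagonal_input {A : Type*} [Fintype A] [DecidableEq A] {m : ℕ} (a : Fin m → A)
    {p : Fin m → ℝ} (hp : ∀ i, 0 ≤ p i) (hp1 : ∑ i, p i = 1) :
    ∑ x, ∑ i, (if x = a i then √(p i) else 0) ^ 2 = 1 := by
  rw [Finset.sum_comm, ← hp1]
  refine Finset.sum_congr rfl fun i _ => ?_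
  simp [ite_pow, Real.sq_sqrt (hp i)]

-- The ancillae keep `i` and `j`, so a term of the purity survives exactly when the discarded
-- components of the output coincide: the purity becomes a weighted count of coincidences of `e`.
open Classical in
theorem purity_amplitude_diagonal_input {A B : Type*} [Fintype A] [Fintype B]
    (e : A × B ≃ A × B) {m n : ℕ} (a : Fin m → A) (b : Fin n → B) {p : Fin m → ℝ}
    {q : Fin n → ℝ} (hp : ∀ i, 0 ≤ p i) (hq : ∀ j, 0 ≤ q j) :
    purity (amplitude e (fun x i => if x = a i then √(p i) else 0)
      (fun y j => if y = b j then √(q j) else 0)) =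
    ∑ i, ∑ i', ∑ j, ∑ j', if ((e (a i, b j)).1 = (e (a i, b j')).1 ∧
        (e (a i', b j)).1 = (e (a i', b j')).1) ∧
        (e (a i, b j)).2 = (e (a i', b j)).2 ∧ (e (a i, b j')).2 = (e (a i', b j')).2
      then p i * p i' * (q j * q j') else 0 := by
  have hM : ∀ x y, amplitude e (fun x i => if x = a i then √(p i) else 0)
      (fun y j => if y = b j then √(q j) else 0) x y =
      √(p x.2) * √(q y.2) * (if (e (a x.2, b y.2)).1 = x.1 then 1 else 0) *
        (if (e (a x.2, b y.2)).2 = y.1 then 1 else 0) := by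
    rintro ⟨x, i⟩ ⟨y, j⟩
    have : e (a i, b j) = (x, y) ↔ (e.symm (x, y)).1 = a i ∧ (e.symm (x, y)).2 = b j := by
      rw [← Equiv.eq_symm_apply, Prod.ext_iff]
      tauto
    rw [Prod.ext_iff] at this
    simp only [amplitude]
    by_cases h1 : (e (a i, b j)).1 = x <;> by_cases h2 : (e (a i, b j)).2 = y <;>
      simp only [h1, h2, and_true, and_false, true_iff, false_iff,
        not_and_or] at this <;> simp [h1, h2, this]
    all_goals tauto
  have hin : ∀ x x' : A × Fin m, ∑ y : B × Fin n,
      amplitude e (fun x i => if x = a i then √(p i) else 0)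
        (fun y j => if y = b j then √(q j) else 0) x y *
      amplitude e (fun x i => if x = a i then √(p i) else 0)
        (fun y j => if y = b j then √(q j) else 0) x' y =
      √(p x.2) * √(p x'.2) * ∑ j, q j * (if (e (a x.2, b j)).1 = x.1 then 1 else 0) *
        (if (e (a x'.2, b j)).1 = x'.1 then 1 else 0) *
        (if (e (a x.2, b j)).2 = (e (a x'.2, b j)).2 then 1 else 0) := by
    intro x x'
    simp only [hM]
    rw [Fintype.sum_prod_type, Finset.sum_comm, Finset.mul_sum]
    refine Finset.sum_congr rfl fun j _ => ?_
    calc _ = ∑ y, √(p x.2) * √(p x'.2) * (√(q j) * √(q j)) *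
          (if (e (a x.2, b j)).1 = x.1 then 1 else 0) *
          (if (e (a x'.2, b j)).1 = x'.1 then 1 else 0) *
          ((if (e (a x.2, b j)).2 = y then 1 else 0) *
          (if (e (a x'.2, b j)).2 = y then 1 else 0)) :=
          Finset.sum_congr rfl fun y _ => by ring
      _ = _ := by
        rw [← Finset.mul_sum, Real.mul_self_sqrt (hq j)]
        simp [eq_comm]
  simp only [purity, hin, Fintype.sum_prod_type]
  rw [Finset.sum_comm]
  refine Finset.sum_congr rfl fun i _ => ?_
  rw [Finset.sum_congr rfl fun x _ => Finset.sum_comm, Finset.sum_comm]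
  refine Finset.sum_congr rfl fun i' _ => ?_
  have hsq : ∀ x x' : A, (√(p i) * √(p i') * ∑ j, q j *
        (if (e (a i, b j)).1 = x then 1 else 0) * (if (e (a i', b j)).1 = x' then 1 else 0) *
        (if (e (a i, b j)).2 = (e (a i', b j)).2 then 1 else 0)) ^ 2 =
      ∑ j, ∑ j', p i * p i' * (q j * q j') *
        (if (e (a i, b j)).2 = (e (a i', b j)).2 then 1 else 0) *
        (if (e (a i, b j')).2 = (e (a i', b j')).2 then 1 else 0) *
        ((if (e (a i, b j)).1 = x then 1 else 0) * (if (e (a i, b j')).1 = x then 1 else 0)) *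
        ((if (e (a i', b j)).1 = x' then 1 else 0) *
          (if (e (a i', b j')).1 = x' then 1 else 0)) := by
    intro x x'
    rw [mul_pow, mul_pow, Real.sq_sqrt (hp i), Real.sq_sqrt (hp i'), pow_two (Finset.sum _ _),
      Finset.sum_mul_sum, Finset.mul_sum]
    refine Finset.sum_congr rfl fun j _ => ?_
    rw [Finset.mul_sum]
    refine Finset.sum_congr rfl fun j' _ => ?_
    ring
  have hdelta : ∀ u v : A, ∑ x, ((if u = x then (1 : ℝ) else 0) * (if v = x then 1 else 0)) =
      if u = v then 1 else 0 := by
    intro u v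
    simp
  simp only [hsq]
  have hcomm : ∀ F : A → A → Fin n → Fin n → ℝ, ∑ x, ∑ x', ∑ j, ∑ j', F x x' j j' =
      ∑ j, ∑ j', ∑ x, ∑ x', F x x' j j' := by
    intro F
    exact (Finset.sum_congr rfl fun x _ => Finset.sum_comm.trans <|
      Finset.sum_congr rfl fun j _ => Finset.sum_comm).trans <| Finset.sum_comm.trans <|
      Finset.sum_congr rfl fun j _ => Finset.sum_comm
  rw [hcomm]
  refine Finset.sum_congr rfl fun j _ => Finset.sum_congr rfl fun j' _ => ?_
  simp only [← Finset.mul_sum, ← Finset.sum_mul, hdelta]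
  simp only [← ite_and, mul_ite, mul_one, mul_zero]
  split_ifs <;> first | rfl | (exfalso; tauto)

open Classical in
theorem hasLowPurityOutput_of_diagonal_input {A B : Type*} [Fintype A] [Fintype B]
    (e : A × B ≃ A × B) {m n : ℕ} (a : Fin m → A) (b : Fin n → B) (p : Fin m → ℝ)
    (q : Fin n → ℝ) (hp : ∀ i, 0 ≤ p i) (hq : ∀ j, 0 ≤ q j) (hp1 : ∑ i, p i = 1)
    (hq1 : ∑ j, q j = 1)
    (h : ∑ i, ∑ i', ∑ j, ∑ j', (if ((e (a i, b j)).1 = (e (a i, b j')).1 ∧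
        (e (a i', b j)).1 = (e (a i', b j')).1) ∧
        (e (a i, b j)).2 = (e (a i', b j)).2 ∧ (e (a i, b j')).2 = (e (a i', b j')).2
      then p i * p i' * (q j * q j') else 0) ≤ 5 / 12) : HasLowPurityOutput e :=
  ⟨m, n, _, _, sum_sq_diagonal_input a hp hp1, sum_sq_diagonal_input b hq hq1,
    (purity_amplitude_diagonal_input e a b hp hq).trans_le h⟩

/-! ### Small inputs and the reduction to controlled permutations -/

theorem hasLowPurityOutput_of_three_values {A B : Type*} [Fintype A] [Fintype B]
    (e : A × B ≃ A × B) (a : A) (b₁ b₂ b₃ : B) (h12 : (e (a, b₁)).1 ≠ (e (a, b₂)).1)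
    (h13 : (e (a, b₁)).1 ≠ (e (a, b₃)).1) (h23 : (e (a, b₂)).1 ≠ (e (a, b₃)).1) :
    HasLowPurityOutput e := by
  refine hasLowPurityOutput_of_diagonal_input e ![a] ![b₁, b₂, b₃] ![1] ![1 / 3, 1 / 3, 1 / 3]
    (by simp) (by simp [Fin.forall_fin_succ]) (by simp)
    (by norm_num [Fin.sum_univ_succ]) ?_
  simp [Fin.sum_univ_succ, h12, h13, h23, h12.symm, h13.symm, h23.symm]
  norm_num

/-- Besides the `25/81` from `i = i'`, `j = j'`, only coincidences along `a₂` or along `b₂` can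
survive, each contributing `4/81`. Total at most `11/27`; uniform weights would only give `1/2`. -/
theorem hasLowPurityOutput_of_corner {A B : Type*} [Fintype A] [Fintype B]
    (e : A × B ≃ A × B) (a₁ a₂ : A) (b₁ b₂ : B) (hf : (e (a₁, b₁)).1 ≠ (e (a₁, b₂)).1)
    (hg : (e (a₁, b₁)).2 ≠ (e (a₂, b₁)).2) :
    HasLowPurityOutput e := by
  classical
  refine hasLowPurityOutput_of_diagonal_input e ![a₁, a₂] ![b₁, b₂] ![2 / 3, 1 / 3]
    ![2 / 3, 1 / 3] (by norm_num [Fin.forall_fin_succ]) (by norm_num [Fin.forall_fin_succ])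
    (by norm_num [Fin.sum_univ_succ]) (by norm_num [Fin.sum_univ_succ]) ?_
  simp only [Fin.sum_univ_two, Matrix.cons_val_zero, Matrix.cons_val_one]
  simp [hf, hg, hf.symm, hg.symm, -mul_ite]
  split_ifs <;> norm_num

/-- If `e` never lowers the purity enough, then it is a controlled permutation. -/
theorem controlled_of_not_hasLowPurityOutput {A B : Type*} [Fintype A] [Fintype B]
    {e : A × B ≃ A × B} (h : ¬ HasLowPurityOutput e) :
    (∀ a b b', (e (a, b)).1 = (e (a, b')).1) ∨ ∀ b a a', (e (a, b)).2 = (e (a', b)).2 := by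
  refine or_iff_not_imp_left.2 fun hf => ?_
  push Not at hf
  obtain ⟨a₀, b₀, b₀', hne⟩ := hf
  have hconst : ∀ b a, (e (a₀, b)).2 = (e (a, b)).2 := by
    intro b a
    by_contra hg
    -- A nonconstant function on `B` differs from its value at any given `b` somewhere, so `(a₀, b)`
    -- is a corner for every such `b`.
    have : ∃ b', (e (a₀, b)).1 ≠ (e (a₀, b')).1 := by
      by_contra! hall
      exact hne ((hall b₀).symm.trans (hall b₀'))
    obtain ⟨b', hb'⟩ := this
    exact h (hasLowPurityOutput_of_corner e a₀ a b b' hb' hg)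
  exact fun b a a' => (hconst b a).symm.trans (hconst b a')

/-! ### Three distinct controlled permutations -/

/-- Each pair of permutations agrees at exactly one of the three points, so the purity is `3/9 +
6/81 = 11/27`. -/
theorem hasLowPurityOutput_of_all_odd {A B : Type*} [Fintype A] [Fintype B]
    {e : A × B ≃ A × B} {f : A → A} {π : A → Equiv.Perm B} (he : ∀ a b, e (a, b) = (f a, π a b))
    {a₁ a₂ a₃ : A} {b₁ b₂ b₃ : B} (h1 : π a₂ b₁ = π a₃ b₁) (h1' : π a₁ b₁ ≠ π a₃ b₁)
    (h2 : π a₁ b₂ = π a₃ b₂) (h2' : π a₂ b₂ ≠ π a₃ b₂) (h3 : π a₁ b₃ = π a₂ b₃)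
    (h3' : π a₁ b₃ ≠ π a₃ b₃) : HasLowPurityOutput e := by
  classical
  refine hasLowPurityOutput_of_diagonal_input e ![a₁, a₂, a₃] ![b₁, b₂, b₃]
    ![1 / 3, 1 / 3, 1 / 3] ![1 / 3, 1 / 3, 1 / 3]
    (by simp [Fin.forall_fin_succ]) (by simp [Fin.forall_fin_succ])
    (by norm_num [Fin.sum_univ_succ]) (by norm_num [Fin.sum_univ_succ]) ?_
  have h3'' := h3 ▸ h3'
  simp [Fin.sum_univ_three, he, h1, h2, h3, h1', h2', h3'', h1'.symm, h2'.symm, h3''.symm]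
  norm_num

/-- With no ancilla on `B`, the reduced state is a third of the Gram matrix of the three vectors
obtained by permuting `β`. -/
theorem purity_amplitude_controlled {A B : Type*} [Fintype A] [DecidableEq A] [Fintype B]
    {e : A × B ≃ A × B} {f : A → A} {π : A → Equiv.Perm B} (he : ∀ a b, e (a, b) = (f a, π a b))
    (a : Fin 3 → A) {α : A → Fin 3 → ℝ} (hα : ∀ x i, α x i = if x = a i then √(1 / 3) else 0)
    (β : B → ℝ) {γ : B → Fin 1 → ℝ} (hγ : ∀ b i, γ b i = β b) :
    purity (amplitude e α γ) =
    1 / 9 * ∑ i, ∑ i', (∑ b, β b * β ((π (a i')).symm (π (a i) b))) ^ 2 := by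
  have hM : ∀ x y, amplitude e α γ x y =
      √(1 / 3) * (if f (a x.2) = x.1 then 1 else 0) * β ((π (a x.2)).symm y.1) := by
    rintro ⟨x, i⟩ ⟨y, j⟩
    obtain ⟨⟨z, b⟩, hz⟩ := e.surjective (x, y)
    have hz' := hz
    rw [he, Prod.mk.injEq] at hz'
    simp only [amplitude, ← hz, e.symm_apply_apply, hα, hγ]
    by_cases hza : z = a i
    · subst hza
      simp [← hz'.1, ← hz'.2]
    · have : f (a i) ≠ x := by
        intro hfx
        have : e (a i, (π (a i)).symm y) = e (z, b) := by
          rw [hz, he, hfx, Equiv.apply_symm_apply]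
        exact hza (Prod.ext_iff.1 (e.injective this)).1.symm
      simp [hza, this]
  have h3 : √(1 / 3 : ℝ) ^ 2 = 1 / 3 := Real.sq_sqrt (by norm_num)
  have hin : ∀ x x' : A × Fin 3, (∑ y : B × Fin 1,
      amplitude e α γ x y * amplitude e α γ x' y) ^ 2
      = 1 / 9 * (if f (a x.2) = x.1 then 1 else 0) * (if f (a x'.2) = x'.1 then 1 else 0) *
        (∑ b, β b * β ((π (a x'.2)).symm (π (a x.2) b))) ^ 2 := by
    intro x x'
    simp only [hM]
    have : ∑ b, β b * β ((π (a x'.2)).symm (π (a x.2) b)) =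
        ∑ b, β ((π (a x.2)).symm b) * β ((π (a x'.2)).symm b) := by
      rw [← Equiv.sum_comp (π (a x.2)) fun b =>
        β ((π (a x.2)).symm b) * β ((π (a x'.2)).symm b)]
      simp
    rw [this, Fintype.sum_prod_type]
    have : ∀ b, √(1 / 3) * (if f (a x.2) = x.1 then 1 else 0) * β ((π (a x.2)).symm b) *
        (√(1 / 3) * (if f (a x'.2) = x'.1 then 1 else 0) * β ((π (a x'.2)).symm b)) =
        √(1 / 3) ^ 2 * (if f (a x.2) = x.1 then 1 else 0) *
        (if f (a x'.2) = x'.1 then 1 else 0) *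
        (β ((π (a x.2)).symm b) * β ((π (a x'.2)).symm b)) := fun b => by ring
    simp only [this, Finset.univ_unique, Finset.sum_singleton, ← Finset.mul_sum]
    rw [h3, mul_pow]
    congr 1
    split_ifs <;> norm_num
  simp only [purity, hin]
  simp only [Fintype.sum_prod_type]
  rw [Finset.sum_comm, Finset.mul_sum]
  refine Finset.sum_congr rfl fun i _ => ?_
  rw [Finset.sum_congr rfl fun x _ => Finset.sum_comm, Finset.sum_comm, Finset.mul_sum]
  refine Finset.sum_congr rfl fun i' _ => ?_
  simp only [← Finset.sum_mul, ← Finset.mul_sum]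
  simp

/-- Two disjoint permutations and the identity, tested on a real vector. -/
theorem exists_vector_of_disjoint {B : Type*} [Fintype B] {σ τ : Equiv.Perm B}
    (hd : σ.Disjoint τ) (hσ : σ ≠ 1) (hτ : τ ≠ 1) : ∃ β : B → ℝ, ∑ b, β b ^ 2 = 34 ∧
      (∑ b, β b * β (σ b)) ^ 2 + (∑ b, β b * β (τ b)) ^ 2 + (∑ b, β b * β (τ.symm (σ b))) ^ 2
        ≤ 418 := by
  classical
  obtain ⟨b, hb⟩ : ∃ b, σ b ≠ b := by
    by_contra! h; exact hσ (Equiv.ext h)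
  obtain ⟨c, hc⟩ : ∃ c, τ c ≠ c := by
    by_contra! h; exact hτ (Equiv.ext h)
  have hτb : τ b = b := (hd b).resolve_left hb
  have hσc : σ c = c := (hd c).resolve_right hc
  have hτσb : τ (σ b) = σ b := (hd (σ b)).resolve_left fun h => hb (σ.injective h)
  have hστc : σ (τ c) = τ c := (hd (τ c)).resolve_right fun h => hc (τ.injective h)
  have hσσb : σ (σ b) ≠ σ b := fun h => hb (σ.injective h)
  have hττc : τ (τ c) ≠ τ c := fun h => hc (τ.injective h)
  have hτσσb : τ (σ (σ b)) = σ (σ b) :=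
    (hd (σ (σ b))).resolve_left fun h => hσσb (σ.injective h)
  have hbc : b ≠ c := fun h => hb (h ▸ hσc)
  have hbτc : b ≠ τ c := fun h => hb (by rw [h]; exact hστc)
  have hσbc : σ b ≠ c := fun h => hc (by rw [← h]; exact hτσb)
  have hσbτc : σ b ≠ τ c := fun h => hττc (by rw [← h]; exact hτσb)
  have hσσbc : σ (σ b) ≠ c := fun h => hc (by rw [← h]; exact hτσσb)
  have hσσbτc : σ (σ b) ≠ τ c := fun h => hττc (by rw [← h]; exact hτσσb)
  have hττcb : τ (τ c) ≠ b := fun h => hbτc (τ.injective (hτb.trans h.symm))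
  have hττcσb : τ (τ c) ≠ σ b := fun h => hσbτc (τ.injective (hτσb.trans h.symm))
  -- One point moved by each permutation gets `4` and its image gets `-1`; the opposite signs lower
  -- the overlaps with `σ` and `τ`. Purity `5/12` allows a sum of squares up to `433.5`.
  set β : B → ℝ := fun x => if x = b then 4 else if x = σ b then -1 else if x = c then 4 else
    if x = τ c then -1 else 0 with hβ
  have hsum : ∀ F : B → ℝ, ∑ x, β x * F x = 4 * F b - F (σ b) + 4 * F c - F (τ c) := by
    intro F
    have : ∀ x, β x * F x = (if x = b then 4 * F x else 0) + (if x = σ b then - F x else 0) +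
        (if x = c then 4 * F x else 0) + (if x = τ c then - F x else 0) := by
      intro x
      simp only [hβ]
      by_cases h1 : x = b
      · subst h1; simp [hb.symm, hbc, hbτc]
      by_cases h2 : x = σ b
      · subst h2; simp [hb, hσbc, hσbτc]
      by_cases h3 : x = c
      · subst h3; simp [hc.symm, hbc.symm, hσbc.symm]
      simp [h1, h2, h3]
    simp only [this, Finset.sum_add_distrib, Finset.sum_ite_eq', Finset.mem_univ, if_true]
    ring
  have vb : β b = 4 := by simp [hβ]
  have vσb : β (σ b) = -1 := by simp [hβ, hb]
  have vc : β c = 4 := by simp [hβ, hbc.symm, hσbc.symm]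
  have vτc : β (τ c) = -1 := by simp [hβ, hbτc.symm, hσbτc.symm, hc]
  have vσσb : β (σ (σ b)) = 4 ∨ β (σ (σ b)) = 0 := by
    simp [hβ, hσσb, hσσbc, hσσbτc]
    tauto
  -- `τ (τ c) = c` exactly when `τ.symm c = τ c`, so the two values are linked.
  have vττc : (β (τ (τ c)) = 4 ∧ β (τ.symm c) = -1) ∨ (β (τ (τ c)) = 0 ∧ β (τ.symm c) = 0) := by
    have i1 : τ.symm c ≠ b := by
      rw [Ne, Equiv.symm_apply_eq, hτb]; exact hbc.symm
    have i2 : τ.symm c ≠ σ b := by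
      rw [Ne, Equiv.symm_apply_eq, hτσb]; exact hσbc.symm
    have i3 : τ.symm c ≠ c := by
      rw [Ne, Equiv.symm_apply_eq]; exact hc.symm
    have i4 : τ.symm c = τ c ↔ τ (τ c) = c := by
      rw [Equiv.symm_apply_eq, eq_comm]
    simp only [hβ, if_neg i1, if_neg i2, if_neg i3, if_neg hττcb, if_neg hττcσb, if_neg hττc, i4]
    by_cases h : τ (τ c) = c <;> simp [h]
  refine ⟨β, ?_, ?_⟩
  · simp only [pow_two, hsum, vb, vσb, vc, vτc]
    norm_num
  · have t1 : τ.symm (σ b) = σ b := by rw [Equiv.symm_apply_eq, hτσb]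
    have t2 : τ.symm (σ (σ b)) = σ (σ b) := by rw [Equiv.symm_apply_eq, hτσσb]
    simp only [hsum, vb, vσb, vc, vτc, hσc, hστc, hτb, hτσb, t1, t2, Equiv.symm_apply_apply]
    -- The sums are 402, 394, 394 and 418; the worst, `9² + 9² + 16²`, occurs when `b` and `c` both
    -- lie on 2-cycles.
    rcases vσσb with h | h <;> rcases vττc with ⟨h1, h2⟩ | ⟨h1, h2⟩ <;> rw [h, h1, h2] <;>
      norm_num

theorem hasLowPurityOutput_of_two_odd {A B : Type*} [Fintype A] [Fintype B]
    {e : A × B ≃ A × B} {f : A → A} {π : A → Equiv.Perm B} (he : ∀ a b, e (a, b) = (f a, π a b))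
    {a₁ a₂ a₃ : A} (h13 : π a₁ ≠ π a₃) (h23 : π a₂ ≠ π a₃)
    (h : ∀ b, π a₁ b = π a₃ b ∨ π a₂ b = π a₃ b) : HasLowPurityOutput e := by
  classical
  have hd : ((π a₃)⁻¹ * π a₁).Disjoint ((π a₃)⁻¹ * π a₂) := by
    intro b
    simp only [Equiv.Perm.mul_apply, Equiv.Perm.inv_eq_iff_eq]
    exact h b
  obtain ⟨β, hβ1, hβ⟩ := exists_vector_of_disjoint hd
    (by rw [Ne, inv_mul_eq_one]; exact h13.symm) (by rw [Ne, inv_mul_eq_one]; exact h23.symm)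
  set γ : B → ℝ := fun b => β b / √34 with hγ
  have h34 : √(34 : ℝ) * √34 = 34 := Real.mul_self_sqrt (by norm_num)
  have hin : ∀ ρ : B → B, ∑ b, γ b * γ (ρ b) = (∑ b, β b * β (ρ b)) / 34 := by
    intro ρ
    rw [Finset.sum_div]
    refine Finset.sum_congr rfl fun b _ => ?_
    simp only [hγ]
    rw [div_mul_div_comm, h34]
  have hsymm : ∀ a a', ∑ b, γ b * γ ((π a').symm (π a b)) =
      ∑ b, γ b * γ ((π a).symm (π a' b)) := by
    intro a a'
    rw [← Equiv.sum_comp ((π a').trans (π a).symm)]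
    refine Finset.sum_congr rfl fun b _ => ?_
    simp [mul_comm]
  have hself : ∀ a, ∑ b, γ b * γ ((π a).symm (π a b)) = 1 := by
    intro a
    rw [hin fun b => (π a).symm (π a b)]
    simp only [Equiv.symm_apply_apply, ← pow_two, hβ1]
    norm_num
  refine ⟨3, 1, fun x i => if x = ![a₁, a₂, a₃] i then √(1 / 3) else 0, fun b _ => γ b, ?_, ?_, ?_⟩
  · exact sum_sq_diagonal_input ![a₁, a₂, a₃] (p := fun _ => 1 / 3) (by norm_num) (by norm_num)
  · simpa [pow_two] using hself a₁
  · rw [purity_amplitude_controlled he ![a₁, a₂, a₃] (fun _ _ => rfl) γ fun _ _ => rfl]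
    have v2 : ![a₁, a₂, a₃] 2 = a₃ := rfl
    simp only [Fin.sum_univ_three, Matrix.cons_val_zero, Matrix.cons_val_one, v2]
    rw [hself, hself, hself, hsymm a₃ a₁, hsymm a₃ a₂, hsymm a₂ a₁,
      hin fun b => (π a₃).symm (π a₁ b), hin fun b => (π a₃).symm (π a₂ b), hin fun b => (π a₂).symm (π a₁ b)]
    simp only [Equiv.Perm.mul_apply, Equiv.Perm.inv_def] at hβ
    have : ∀ b, ((π a₃)⁻¹ * π a₂).symm ((π a₃).symm (π a₁ b)) = (π a₂).symm (π a₁ b) := by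
      intro b
      rw [Equiv.symm_apply_eq]
      simp
    simp only [Equiv.Perm.inv_def] at this
    simp only [this] at hβ
    simp only [div_pow]
    linarith

/-! ### Case analysis for controlled permutations -/

theorem hasLowPurityOutput_of_controlled {A B : Type*} [Fintype A] [Fintype B] [DecidableEq A]
    [DecidableEq B] {U : Matrix (A × B) (A × B) ℂ} {e : A × B ≃ A × B}
    (hU : ∀ x y, U x y = if e y = x then 1 else 0) {r : ℕ} (hr : HasSchmidtRank U r) (hr2 : 2 < r)
    (hc : ∀ a b b', (e (a, b)).1 = (e (a, b')).1) : HasLowPurityOutput e := by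
  rcases isEmpty_or_nonempty B with hB | ⟨⟨b₀⟩⟩
  · have := hr.le_card ∅ fun a' a => by
      rw [Subsingleton.elim (block U a' a) 0]
      exact Submodule.zero_mem _
    simp at this
    omega
  have hinj : ∀ a, Function.Injective fun b => (e (a, b)).2 := fun a b b' h =>
    (Prod.ext_iff.1 (e.injective (Prod.ext (hc a b b') h))).2
  obtain ⟨π, hπ⟩ : ∃ π : A → Equiv.Perm B, ∀ a b, π a b = (e (a, b)).2 :=
    ⟨fun a => Equiv.ofBijective _ (Finite.injective_iff_bijective.1 (hinj a)), fun _ _ => rfl⟩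
  have he : ∀ a b, e (a, b) = ((e (a, b₀)).1, π a b) := fun a b =>
    Prod.ext (hc a b b₀) (hπ a b).symm
  obtain ⟨a₁, a₂, a₃, h12, h13, h23⟩ := exists_three_controlled (g := fun a => π a) hU he hr hr2
  have h12' : π a₁ ≠ π a₂ := fun h => h12 (congrArg _ h)
  have h13' : π a₁ ≠ π a₃ := fun h => h13 (congrArg _ h)
  have h23' : π a₂ ≠ π a₃ := fun h => h23 (congrArg _ h)
  by_contra hlow
  have htwo : ∀ b, π a₁ b = π a₂ b ∨ π a₁ b = π a₃ b ∨ π a₂ b = π a₃ b := by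
    intro b
    by_contra! h
    simp only [hπ] at h
    obtain ⟨k1, k2, k3⟩ := h
    exact hlow (hasLowPurityOutput_of_exchange
      (hasLowPurityOutput_of_three_values (exchange e) b a₁ a₂ a₃ k1 k2 k3))
  -- `k` must differ from both others somewhere, since otherwise the other two are disjoint relative
  -- to it.
  have odd : ∀ {i j k : A}, π i ≠ π k → π j ≠ π k → ∃ b, π i b ≠ π k b ∧ π j b ≠ π k b := by
    intro i j k hik hjk
    by_contra! h
    exact hlow (hasLowPurityOutput_of_two_odd he hik hjk fun b => or_iff_not_imp_left.2 (h b))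
  obtain ⟨b₁, h1, h1'⟩ := odd h12'.symm h13'.symm
  obtain ⟨b₂, h2, h2'⟩ := odd h12' h23'.symm
  obtain ⟨b₃, h3, h3'⟩ := odd h13' h23'
  exact hlow (hasLowPurityOutput_of_all_odd he
    (((htwo b₁).resolve_left h1.symm).resolve_left h1'.symm) h1'.symm
    (((htwo b₂).resolve_left h2).resolve_right h2'.symm) h2'.symm
    ((htwo b₃).resolve_right fun h => h.elim h3 h3') h3)

end EntanglingPower

theorem proposition7 (dA dB : ℕ)
    (U : Matrix (Fin dA × Fin dB) (Fin dA × Fin dB) ℂ)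
    (hU : EntanglingPower.IsPermutationUnitary U)
    (r : ℕ) (hr : EntanglingPower.HasSchmidtRank U r) (hr2 : 2 < r) :
    (((1.223 : ℝ)) : EReal) < EntanglingPower.entanglingPower U := by
  obtain ⟨e, he⟩ := hU.exists_equiv
  refine EntanglingPower.lt_entanglingPower he ?_
  by_contra hlow
  rcases EntanglingPower.controlled_of_not_hasLowPurityOutput hlow with hc | hc
  · exact hlow (EntanglingPower.hasLowPurityOutput_of_controlled he hr hr2 hc)
  · refine hlow (EntanglingPower.hasLowPurityOutput_of_exchange
      (EntanglingPower.hasLowPurityOutput_of_controlled (U := U.submatrix Prod.swap Prod.swap)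
        ?_ hr.exchange hr2 fun b a a' => hc b a a'))
    rintro ⟨b, a⟩ ⟨b', a'⟩
    simp [he, EntanglingPower.exchange, Prod.ext_iff, and_comm]
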